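/- **Conventions.** For a $2\pi$-periodic function $f:\mathbb R\to\mathbb C$ integrable on $[-\pi,\pi]$ let $\hat f(n)=\int_{-\pi}^{\pi}f(t)e^{-int}\,dt$ for $n\in\mathbb Z$, and let $\|f\|_{\mathbb T}=\sup_{|I|\le 2\pi}\left|\int_I f\right|$, the supremum being over intervals $I$ of length at most $2\pi$ (Alexiewicz norm). For a $2\pi$-periodic $u:\mathbb R\to\mathbb R$ let $Vu=\sup\sum_i|u(s_i)-u(t_i)|$ over finite families of disjoint open intervals $(s_i,t_i)\subseteq(-\pi,\pi)$ (so $s_i=-\pi$ and $t_i=\pi$ are allowed). $\mathcal{BV}(\mathbb T)$ is the space of $2\pi$-periodic $g:\mathbb R\to\mathbb C$ with $V(\operatorname{Re}g)<\infty$ and $V(\operatorname{Im}g)<\infty$; its norm is $\|g\|_{\mathcal{BV}}=\sup_{t}|g(t)|+Vg$, where $Vg=\sqrt{(V\operatorname{Re}g)^2+(V\operatorname{Im}g)^2}$. A trigonometric polynomial is a finite sum $p(t)=\sum_k b_ke^{ikt}$ with $b_k\in\mathbb C$. For a sequence $(a_n)_{n\in\mathbb Z}$ in $\mathbb C$ and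 $c\in\mathbb R$ consider (a)$_c$: there is $g\in\mathcal{BV}(\mathbb T)$ with $\|g\|_{\mathcal{BV}}\le c$ and $\hat g(n)=a_n$ for all $n\in\mathbb Z$; (b)$_c$: $\left|\sum_{n\in\mathbb Z}\hat p(n)\overline{a_n}\right|\le c\,\|p\|_{\mathbb T}$ for all trigonometric polynomials $p$. **Theorem.** Let $(a_n)_{n\in\mathbb Z}$ be a sequence in $\mathbb C$. Then (a)$_c$ holds for some $c\ge0$ if and only if (b)$_c$ holds for some $c\ge 0$. More precisely, for every $c\ge0$, (b)$_c$ implies (a)$_c$, and (a)$_c$ implies (b)$_{2\pi c}$. **Corollary.** Let $(a_n)_{n\in\mathbb Z}$ be a sequence in $\mathbb C$, let $c\in\mathbb R$, and for $n\ge0$ let $$\sigma_n(t)=\frac1{2\pi}\sum_{k=-n}^{n}\left(1-\frac{|k|}{n+1}\right)a_ke^{ikt}$$ be the Fejér means of the trigonometric series with coefficients $(a_n)$. Then $(a_n)$ is the Fourier coefficient sequence of some $g\in\mathcal{BV}(\mathbb T)$ with $\|g\|_{\mathcal{BV}}\le c$ if and only if $\|\sigma_n\|_{\mathcal{BV}}\le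 c$ for all integers $n\ge0$. -/

import Mathlib

noncomputable section

/-- The (unnormalised) Fourier coefficient `∫_{-π}^{π} f(t) e^{-int} dt`. -/
def torusFourierCoeff (f : ℝ → ℂ) (n : ℤ) : ℂ :=
  ∫ t in (-Real.pi)..Real.pi, f t * Complex.exp (-(Complex.I * (n : ℂ) * (t : ℂ)))

/-- Trigonometric polynomials: finite complex linear combinations of the functions `e^{ikt}`. -/
def IsTrigPoly (p : ℝ → ℂ) : Prop :=
  ∃ (s : Finset ℤ) (b : ℤ → ℂ),
    p = fun t : ℝ => ∑ k ∈ s, b k * Complex.exp (Complex.I * (k : ℂ) * (t : ℂ))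

/-- The Alexiewicz norm: the supremum of `|∫_I f|` over intervals `I` of length at most `2π`. -/
def alexiewiczNorm (f : ℝ → ℂ) : ℝ :=
  sSup {r : ℝ | ∃ α β : ℝ, α ≤ β ∧ β - α ≤ 2 * Real.pi ∧ r = ‖∫ t in α..β, f t‖}

/-- The variation over the torus of a `2π`-periodic real function: the supremum of
`∑ |u(s_i) - u(t_i)|` over finite families of disjoint open intervals
`(s_i, t_i) ⊆ (-π, π)`. The end points `s_i = -π` and `t_i = π` are allowed. -/
def torusVar (u : ℝ → ℝ) : ℝ :=
  (eVariationOn u (Set.Icc (-Real.pi) Real.pi)).toReal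

/-- The complex-valued `2π`-periodic functions whose real and imaginary parts have finite
variation over the torus. -/
def MemBV (g : ℝ → ℂ) : Prop :=
  Function.Periodic g (2 * Real.pi) ∧
    BoundedVariationOn (fun t => (g t).re) (Set.Icc (-Real.pi) Real.pi) ∧
    BoundedVariationOn (fun t => (g t).im) (Set.Icc (-Real.pi) Real.pi)

/-- The norm `‖g‖_∞ + Vg`, with `Vg = √((V Re g)² + (V Im g)²)`. -/
def bvNorm (g : ℝ → ℂ) : ℝ :=
  (⨆ t : ℝ, ‖g t‖) +
    Real.sqrt (torusVar (fun t => (g t).re) ^ 2 + torusVar (fun t => (g t).im) ^ 2)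

/-- The `n`-th Fejér mean `(1/2π) ∑_{k=-n}^{n} (1 - |k|/(n+1)) a_k e^{ikt}` of the series with
coefficients `a` (for `a` the Fourier coefficients of `g`, the `n`-th Fejér mean of `g`). -/
def fejerMean (a : ℤ → ℂ) (n : ℕ) (t : ℝ) : ℂ :=
  (1 / (2 * (Real.pi : ℂ))) * ∑ k ∈ Finset.Icc (-(n : ℤ)) (n : ℤ),
    (((1 - |(k : ℝ)| / ((n : ℝ) + 1) : ℝ)) : ℂ) * a k *
      Complex.exp (Complex.I * (k : ℂ) * (t : ℂ))

/-- `a` is the sequence of Fourier coefficients of a function of bounded variation of norm at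
most `c`. -/
def IsBVCoeff (a : ℤ → ℂ) (c : ℝ) : Prop :=
  ∃ g : ℝ → ℂ, MemBV g ∧ bvNorm g ≤ c ∧ ∀ n : ℤ, torusFourierCoeff g n = a n

/-- `|∑ p̂(n) conj(a_n)| ≤ c ‖p‖` for all trigonometric polynomials `p`, with the Alexiewicz norm.
The sum has finitely many nonzero terms. -/
def PairingBound (a : ℤ → ℂ) (c : ℝ) : Prop :=
  ∀ p : ℝ → ℂ, IsTrigPoly p →
    ‖∑' n : ℤ, torusFourierCoeff p n * (starRingEnd ℂ) (a n)‖ ≤ c * alexiewiczNorm p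

end

open Filter Topology Set

/-! ### Functions of bounded variation and Riemann sums -/

/-! Everything turns on the Fejér means σ_n.

From BV to the pairing: the pairing equals 2π ∫ p·conj g over a period, so a Hölder inequality |∫
p·conj g| ≤ ‖p‖·‖g‖_BV is needed (`norm_integral_mul_conj_le`). Integration by parts gives a
boundary term (∫p)·conj g(π), controlled by the sup norm, plus a term bounded by sup |P - c| times
the variation of g, where P is a primitive of p and the constant c is free. The curve P has diameter
at most ‖p‖, so a good c makes sup |P - c| ≤ ‖p‖/√2, while the complex variation is at most V Re g +
V Im g ≤ √2·Vg. The two factors √2 cancel.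

From the pairing to σ_n: pairing with a translate of the Fejér kernel evaluates σ_n at a point, so
sums of values or increments of σ_n are pairings with combinations of translates. Their Alexiewicz
norms are bounded because a primitive of the kernel is increasing and grows by 2π over a period.
This gives sup |σ_n| ≤ c/(2π) and variation at most c/π, and these constants are small enough that
‖σ_n‖_BV ≤ c (`PairingBound.bvNorm_fejerMean_le`).

From σ_n to BV: if ‖σ_n‖_BV ≤ c for all n, a pointwise limit g along a nonprincipal ultrafilter
plays the role of Helly's selection theorem. Lower semicontinuity of variation gives ‖g‖_BV ≤ c, and
the uniform variation bound lets Fourier integrals pass to the limit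
(`isBVCoeff_of_bvNorm_fejerMean_le`).

The remaining half of the corollary holds because σ_n is the average of translates of g against a
positive kernel of mean one, which increases neither the sup norm nor the variations of the real and
imaginary parts. -/

theorem BoundedVariationOn.intervalIntegrable_real {u : ℝ → ℝ} {a b : ℝ} (hab : a ≤ b)
    (hu : BoundedVariationOn u (Icc a b)) : IntervalIntegrable u MeasureTheory.volume a b := by
  obtain ⟨p, q, hp, hq, rfl⟩ :=
    hu.locallyBoundedVariationOn.exists_monotoneOn_sub_monotoneOn
  rw [← uIcc_of_le hab] at hp hq
  exact hp.intervalIntegrable.sub hq.intervalIntegrable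

theorem eVariationOn_re_le (g : ℝ → ℂ) (s : Set ℝ) :
    eVariationOn (fun t => (g t).re) s ≤ eVariationOn g s := by
  refine iSup_le fun p => le_trans (Finset.sum_le_sum fun i _ => ?_)
    (eVariationOn.sum_le p.2.2.1 p.2.2.2)
  rw [edist_dist, edist_dist, Real.dist_eq, Complex.dist_eq, ← Complex.sub_re]
  exact ENNReal.ofReal_le_ofReal (Complex.abs_re_le_norm _)

theorem eVariationOn_im_le (g : ℝ → ℂ) (s : Set ℝ) :
    eVariationOn (fun t => (g t).im) s ≤ eVariationOn g s := by
  refine iSup_le fun p => le_trans (Finset.sum_le_sum fun i _ => ?_)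
    (eVariationOn.sum_le p.2.2.1 p.2.2.2)
  rw [edist_dist, edist_dist, Real.dist_eq, Complex.dist_eq, ← Complex.sub_im]
  exact ENNReal.ofReal_le_ofReal (Complex.abs_im_le_norm _)

theorem eVariationOn_le_re_add_im (g : ℝ → ℂ) (s : Set ℝ) :
    eVariationOn g s ≤ eVariationOn (fun t => (g t).re) s + eVariationOn (fun t => (g t).im) s := by
  refine iSup_le fun p => le_trans ?_ (add_le_add
    (eVariationOn.sum_le (n := p.1) p.2.2.1 p.2.2.2)
    (eVariationOn.sum_le (n := p.1) p.2.2.1 p.2.2.2))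
  rw [← Finset.sum_add_distrib]
  refine Finset.sum_le_sum fun i _ => ?_
  rw [edist_dist, edist_dist, edist_dist, Real.dist_eq, Real.dist_eq, Complex.dist_eq,
    ← Complex.sub_im, ← Complex.sub_re, ← ENNReal.ofReal_add (abs_nonneg _) (abs_nonneg _)]
  exact ENNReal.ofReal_le_ofReal (Complex.norm_le_abs_re_add_abs_im _)

theorem BoundedVariationOn.intervalIntegrable_complex {g : ℝ → ℂ} {a b : ℝ} (hab : a ≤ b)
    (hg : BoundedVariationOn g (Icc a b)) : IntervalIntegrable g MeasureTheory.volume a b := by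
  have hre : BoundedVariationOn (fun t => (g t).re) (Icc a b) :=
    ne_top_of_le_ne_top hg (eVariationOn_re_le g _)
  have him : BoundedVariationOn (fun t => (g t).im) (Icc a b) :=
    ne_top_of_le_ne_top hg (eVariationOn_im_le g _)
  have h1 := hre.intervalIntegrable_real hab
  have h2 := him.intervalIntegrable_real hab
  rw [intervalIntegrable_iff] at h1 h2 ⊢
  have := h1.ofReal (𝕜 := ℂ) |>.add ((h2.ofReal (𝕜 := ℂ)).mul_const Complex.I)
  refine this.congr (Eventually.of_forall fun t => ?_)
  simp [Complex.re_add_im]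

/-- The `i`-th point of the partition of `[a, b]` into `N` intervals of equal length. -/
noncomputable def gridPoint (a b : ℝ) (N i : ℕ) : ℝ := a + i * ((b - a) / N)

theorem gridPoint_monotone {a b : ℝ} (hab : a ≤ b) (N : ℕ) : Monotone (gridPoint a b N) := by
  intro i j hij
  have : (i : ℝ) ≤ j := by exact_mod_cast hij
  have h2 : 0 ≤ (b - a) / N := div_nonneg (by linarith) (by positivity)
  unfold gridPoint
  nlinarith

theorem gridPoint_zero (a b : ℝ) (N : ℕ) : gridPoint a b N 0 = a := by simp [gridPoint]

theorem gridPoint_last (a b : ℝ) {N : ℕ} (hN : 0 < N) : gridPoint a b N N = b := by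
  have : (N : ℝ) ≠ 0 := by positivity
  simp only [gridPoint]; field_simp; ring

theorem gridPoint_succ_sub (a b : ℝ) (N i : ℕ) :
    gridPoint a b N (i + 1) - gridPoint a b N i = (b - a) / N := by
  simp only [gridPoint]; push_cast; ring

theorem gridPoint_mem {a b : ℝ} (hab : a ≤ b) {N i : ℕ} (hN : 0 < N) (hi : i ≤ N) :
    gridPoint a b N i ∈ Icc a b := by
  constructor
  · have := gridPoint_monotone hab N (Nat.zero_le i); rwa [gridPoint_zero] at this
  · have := gridPoint_monotone hab N hi; rwa [gridPoint_last a b hN] at this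

/-- The left Riemann sum of `g` over `[a, b]` with respect to the density `φ`. -/
noncomputable def riemannSum (φ g : ℝ → ℂ) (a b : ℝ) (N : ℕ) : ℂ :=
  ∑ i ∈ Finset.range N,
    (∫ t in gridPoint a b N i..gridPoint a b N (i + 1), φ t) * g (gridPoint a b N i)

theorem sum_norm_sub_le {g : ℝ → ℂ} {a b C : ℝ} (hab : a ≤ b) (hC : 0 ≤ C)
    (hg : eVariationOn g (Icc a b) ≤ ENNReal.ofReal C) {N : ℕ} (hN : 0 < N) :
    ∑ i ∈ Finset.range N, ‖g (gridPoint a b N (i + 1)) - g (gridPoint a b N i)‖ ≤ C := by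
  have h := (eVariationOn.sum_le_of_monotoneOn_Iic (f := g) (s := Icc a b) (n := N)
    ((gridPoint_monotone hab N).monotoneOn _) (fun i hi => gridPoint_mem hab hN hi)).trans hg
  simp_rw [edist_dist, dist_eq_norm] at h
  rw [← ENNReal.ofReal_sum_of_nonneg (fun _ _ => norm_nonneg _)] at h
  exact (ENNReal.ofReal_le_ofReal_iff hC).1 h

/-- On each cell g differs from its left value by at most its variation there, and these variations
add up. The error is O(1/N) with a constant that sees g only through C, hence is uniform over
families of bounded variation. -/
theorem norm_integral_sub_riemannSum_le {φ g : ℝ → ℂ} {a b C M : ℝ} (hab : a ≤ b)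
    (hφ : Continuous φ) (hM : ∀ t, ‖φ t‖ ≤ M) (hC : 0 ≤ C)
    (hg : eVariationOn g (Icc a b) ≤ ENNReal.ofReal C) {N : ℕ} (hN : 0 < N) :
    ‖(∫ t in a..b, φ t * g t) - riemannSum φ g a b N‖ ≤ M * ((b - a) / N) * C := by
  have hM0 : 0 ≤ M := (norm_nonneg _).trans (hM 0)
  have hbv : BoundedVariationOn g (Icc a b) := ne_top_of_le_ne_top ENNReal.ofReal_ne_top hg
  have hmono := gridPoint_monotone hab N
  have hsub : ∀ i < N, Icc (gridPoint a b N i) (gridPoint a b N (i + 1)) ⊆ Icc a b :=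
    fun i hi => Icc_subset_Icc (gridPoint_mem hab hN hi.le).1 (gridPoint_mem hab hN hi).2
  have hint : ∀ i < N, IntervalIntegrable (fun t => φ t * g t) MeasureTheory.volume
      (gridPoint a b N i) (gridPoint a b N (i + 1)) := fun i hi =>
    ((hbv.mono (hsub i hi)).intervalIntegrable_complex (hmono i.le_succ)).continuousOn_mul
      hφ.continuousOn
  have hsplit : (∫ t in a..b, φ t * g t) = ∑ i ∈ Finset.range N,
      ∫ t in gridPoint a b N i..gridPoint a b N (i + 1), φ t * g t := by
    rw [intervalIntegral.sum_integral_adjacent_intervals hint, gridPoint_zero,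
      gridPoint_last a b hN]
  have hpiece : ∀ i ∈ Finset.range N,
      ‖(∫ t in gridPoint a b N i..gridPoint a b N (i + 1), φ t * g t) -
        (∫ t in gridPoint a b N i..gridPoint a b N (i + 1), φ t) * g (gridPoint a b N i)‖ ≤
      M * ((b - a) / N) *
        (eVariationOn g (Icc (gridPoint a b N i) (gridPoint a b N (i + 1)))).toReal := by
    intro i hi
    have hi' := Finset.mem_range.1 hi
    have hle := hmono i.le_succ
    have hcont : Continuous fun t => φ t * g (gridPoint a b N i) := hφ.mul continuous_const
    rw [← intervalIntegral.integral_mul_const, ← intervalIntegral.integral_sub (hint i hi')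
      (hcont.intervalIntegrable _ _)]
    refine (intervalIntegral.norm_integral_le_of_norm_le_const (C := M *
      (eVariationOn g (Icc (gridPoint a b N i) (gridPoint a b N (i + 1)))).toReal) ?_).trans ?_
    · intro t ht
      rw [uIoc_of_le hle] at ht
      rw [← mul_sub, norm_mul]
      refine mul_le_mul (hM t) ?_ (norm_nonneg _) hM0
      rw [← dist_eq_norm]
      exact (hbv.mono (hsub i hi')).dist_le ⟨ht.1.le, ht.2⟩ ⟨le_rfl, hle⟩
    · rw [gridPoint_succ_sub, abs_of_nonneg (div_nonneg (by linarith) (by positivity))]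
      exact le_of_eq (by ring)
  have hvar : ∑ i ∈ Finset.range N,
      (eVariationOn g (Icc (gridPoint a b N i) (gridPoint a b N (i + 1)))).toReal ≤ C := by
    rw [← ENNReal.toReal_sum fun i hi => hbv.mono (hsub i (Finset.mem_range.1 hi)),
      eVariationOn.sum' g hmono, gridPoint_zero, gridPoint_last a b hN]
    exact ENNReal.toReal_le_of_le_ofReal hC hg
  rw [hsplit, riemannSum, ← Finset.sum_sub_distrib]
  refine (norm_sum_le_of_le _ hpiece).trans ?_
  rw [← Finset.mul_sum]
  exact mul_le_mul_of_nonneg_left hvar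
    (mul_nonneg hM0 (div_nonneg (by linarith) (by positivity)))

/-- Pointwise limits of functions of uniformly bounded variation commute with integration. -/
theorem tendsto_integral_of_eVariationOn_le {ι : Type*} {l : Filter ι} {F : ι → ℝ → ℂ}
    {φ g : ℝ → ℂ} {a b C M : ℝ} (hab : a ≤ b) (hφ : Continuous φ) (hM : ∀ t, ‖φ t‖ ≤ M)
    (hC : 0 ≤ C) (hF : ∀ i, eVariationOn (F i) (Icc a b) ≤ ENNReal.ofReal C)
    (hg : eVariationOn g (Icc a b) ≤ ENNReal.ofReal C)
    (hlim : ∀ t, Tendsto (fun i => F i t) l (𝓝 (g t))) :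
    Tendsto (fun i => ∫ t in a..b, φ t * F i t) l (𝓝 (∫ t in a..b, φ t * g t)) := by
  rw [Metric.tendsto_nhds]
  intro ε hε
  -- N is fixed before i, so only finitely many point values of `F i` have to converge. This works
  -- along any filter, where dominated convergence may fail.
  obtain ⟨N, hN, hN0⟩ := (((tendsto_const_div_atTop_nhds_zero_nat (M * (b - a) * C)).eventually
    (gt_mem_nhds (show (0 : ℝ) < ε / 3 by positivity))).and (eventually_gt_atTop 0)).exists
  have hN' : M * ((b - a) / N) * C < ε / 3 := by
    calc _ = M * (b - a) * C / N := by ring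
      _ < _ := hN
  have hsum : Tendsto (fun i => riemannSum φ (F i) a b N) l (𝓝 (riemannSum φ g a b N)) :=
    tendsto_finsetSum _ fun i _ => (hlim _).const_mul _
  filter_upwards [(Metric.tendsto_nhds.1 hsum) (ε / 3) (by positivity)] with i hi
  have h1 := norm_integral_sub_riemannSum_le hab hφ hM hC (hF i) hN0
  have h2 := norm_integral_sub_riemannSum_le hab hφ hM hC hg hN0
  rw [← dist_eq_norm] at h1 h2
  have := dist_triangle4 (∫ t in a..b, φ t * F i t) (riemannSum φ (F i) a b N)
    (riemannSum φ g a b N) (∫ t in a..b, φ t * g t)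
  rw [dist_comm (riemannSum φ g a b N)] at this
  linarith

/-- Summation by parts for Riemann sums whose end values agree. -/
theorem norm_riemannSum_le {φ g : ℝ → ℂ} {a b C R : ℝ} (c : ℂ) (hab : a ≤ b)
    (hφ : Continuous φ) (hC : 0 ≤ C) (hg : eVariationOn g (Icc a b) ≤ ENNReal.ofReal C)
    (hper : g a = g b) (hR : ∀ x ∈ Icc a b, ‖(∫ t in a..x, φ t) - c‖ ≤ R) {N : ℕ} (hN : 0 < N) :
    ‖riemannSum φ g a b N‖ ≤ ‖∫ t in a..b, φ t‖ * ‖g b‖ + R * C := by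
  set Q : ℝ → ℂ := fun x => (∫ t in a..x, φ t) - c with hQ
  have hR0 : 0 ≤ R := (norm_nonneg _).trans (hR a ⟨le_rfl, hab⟩)
  have hdiff : ∀ x y, ∫ t in x..y, φ t = Q y - Q x := by
    intro x y
    simp only [hQ, sub_sub_sub_cancel_right]
    rw [intervalIntegral.integral_interval_sub_left] <;> exact hφ.intervalIntegrable _ _
  have habel : ∀ n : ℕ, ∑ i ∈ Finset.range n,
      (∫ t in gridPoint a b N i..gridPoint a b N (i + 1), φ t) * g (gridPoint a b N i) =
      Q (gridPoint a b N n) * g (gridPoint a b N n) -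
        Q (gridPoint a b N 0) * g (gridPoint a b N 0) -
      ∑ i ∈ Finset.range n, Q (gridPoint a b N (i + 1)) *
        (g (gridPoint a b N (i + 1)) - g (gridPoint a b N i)) := by
    intro n
    induction n with
    | zero => simp
    | succ n ih => rw [Finset.sum_range_succ, ih, Finset.sum_range_succ, hdiff]; ring
  -- Equal end values merge the boundary terms into (Q b - Q a)·g b, where c cancels; this leaves c
  -- free in the variation term.
  rw [riemannSum, habel N, gridPoint_zero, gridPoint_last a b hN, hper, ← sub_mul, ← hdiff]
  refine (norm_sub_le _ _).trans (add_le_add (norm_mul_le _ _) ?_)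
  refine (norm_sum_le _ _).trans ?_
  refine le_trans ?_ (mul_le_mul_of_nonneg_left (sum_norm_sub_le hab hC hg hN) hR0)
  rw [Finset.mul_sum]
  refine Finset.sum_le_sum fun i hi => ?_
  rw [norm_mul]
  exact mul_le_mul_of_nonneg_right
    (hR _ (gridPoint_mem hab hN (Finset.mem_range.1 hi))) (norm_nonneg _)

theorem norm_integral_mul_le_of_eVariationOn_le {φ g : ℝ → ℂ} {a b C M R : ℝ} (c : ℂ)
    (hab : a ≤ b) (hφ : Continuous φ) (hM : ∀ t, ‖φ t‖ ≤ M) (hC : 0 ≤ C)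
    (hg : eVariationOn g (Icc a b) ≤ ENNReal.ofReal C) (hper : g a = g b)
    (hR : ∀ x ∈ Icc a b, ‖(∫ t in a..x, φ t) - c‖ ≤ R) :
    ‖∫ t in a..b, φ t * g t‖ ≤ ‖∫ t in a..b, φ t‖ * ‖g b‖ + R * C := by
  have hlim : Tendsto (fun N : ℕ => ‖∫ t in a..b, φ t‖ * ‖g b‖ + R * C + M * (b - a) * C / N)
      atTop (𝓝 (‖∫ t in a..b, φ t‖ * ‖g b‖ + R * C + 0)) :=
    tendsto_const_nhds.add (tendsto_const_div_atTop_nhds_zero_nat _)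
  rw [add_zero] at hlim
  refine ge_of_tendsto hlim ((eventually_gt_atTop 0).mono fun N hN => ?_)
  have h1 := norm_integral_sub_riemannSum_le hab hφ hM hC hg hN
  have h2 := norm_riemannSum_le c hab hφ hC hg hper hR hN
  have h3 := norm_le_norm_sub_add (∫ t in a..b, φ t * g t) (riemannSum φ g a b N)
  have h4 : M * ((b - a) / N) * C = M * (b - a) * C / N := by ring
  linarith

/-! ### Trigonometric polynomials and the Fejér kernel -/

theorem integral_exp_int (k : ℤ) :
    ∫ t in (-Real.pi)..Real.pi, Complex.exp (Complex.I * (k : ℂ) * (t : ℂ)) =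
      if k = 0 then 2 * (Real.pi : ℂ) else 0 := by
  split_ifs with hk
  · subst hk
    simp; ring
  · have hc : Complex.I * (k : ℂ) ≠ 0 := mul_ne_zero Complex.I_ne_zero (by exact_mod_cast hk)
    rw [integral_exp_mul_complex hc]
    have : Complex.exp (Complex.I * (k : ℂ) * ((Real.pi : ℝ) : ℂ)) =
        Complex.exp (Complex.I * (k : ℂ) * ((-Real.pi : ℝ) : ℂ)) := by
      rw [Complex.exp_eq_exp_iff_exists_int]
      exact ⟨k, by push_cast; ring⟩
    rw [this, sub_self, zero_div]

theorem continuous_exp_int (k : ℤ) :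
    Continuous fun t : ℝ => Complex.exp (Complex.I * (k : ℂ) * (t : ℂ)) := by fun_prop

theorem norm_exp_int (k : ℤ) (t : ℝ) : ‖Complex.exp (Complex.I * (k : ℂ) * (t : ℂ))‖ = 1 := by
  rw [show Complex.I * (k : ℂ) * (t : ℂ) = ((k * t : ℝ) : ℂ) * Complex.I by push_cast; ring,
    Complex.norm_exp_ofReal_mul_I]

theorem periodic_exp_int (k : ℤ) :
    Function.Periodic (fun t : ℝ => Complex.exp (Complex.I * (k : ℂ) * (t : ℂ)))
      (2 * Real.pi) := by
  intro t
  simp only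
  rw [Complex.exp_eq_exp_iff_exists_int]
  exact ⟨k, by push_cast; ring⟩

theorem torusFourierCoeff_trigPoly (s : Finset ℤ) (b : ℤ → ℂ) (n : ℤ) :
    torusFourierCoeff
      (fun t : ℝ => ∑ k ∈ s, b k * Complex.exp (Complex.I * (k : ℂ) * (t : ℂ))) n =
      if n ∈ s then 2 * (Real.pi : ℂ) * b n else 0 := by
  unfold torusFourierCoeff
  have h : ∀ t : ℝ, (∑ k ∈ s, b k * Complex.exp (Complex.I * (k : ℂ) * (t : ℂ))) *
      Complex.exp (-(Complex.I * (n : ℂ) * (t : ℂ))) =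
      ∑ k ∈ s, b k * Complex.exp (Complex.I * ((k - n : ℤ) : ℂ) * (t : ℂ)) := by
    intro t
    rw [Finset.sum_mul]
    refine Finset.sum_congr rfl fun k _ => ?_
    rw [mul_assoc, ← Complex.exp_add]
    congr 2
    push_cast; ring
  simp_rw [h]
  rw [intervalIntegral.integral_finsetSum fun k _ =>
    ((continuous_exp_int (k - n)).const_mul (b k)).intervalIntegrable _ _]
  simp_rw [intervalIntegral.integral_const_mul, integral_exp_int, sub_eq_zero]
  simp only [mul_ite, mul_zero, Finset.sum_ite_eq']
  split_ifs <;> ring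

theorem tsum_torusFourierCoeff_trigPoly (s : Finset ℤ) (b a : ℤ → ℂ) :
    ∑' n : ℤ, torusFourierCoeff
      (fun t : ℝ => ∑ k ∈ s, b k * Complex.exp (Complex.I * (k : ℂ) * (t : ℂ))) n *
        (starRingEnd ℂ) (a n) =
      ∑ k ∈ s, 2 * (Real.pi : ℂ) * b k * (starRingEnd ℂ) (a k) := by
  rw [tsum_eq_sum (s := s)]
  · refine Finset.sum_congr rfl fun k hk => ?_
    rw [torusFourierCoeff_trigPoly, if_pos hk]
  · intro k hk
    rw [torusFourierCoeff_trigPoly, if_neg hk, zero_mul]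

theorem sum_pow_mul_pow_inv {z w : ℂ} (hzw : z * w = 1) (n : ℕ) :
    (∑ j ∈ Finset.range (n + 1), z ^ j) * w ^ (n + 1) =
      ∑ k ∈ Finset.range (n + 1), w ^ (k + 1) := by
  induction n with
  | zero => simp
  | succ n ih =>
    rw [Finset.sum_range_succ _ (n + 1), Finset.sum_range_succ' _ (n + 1), add_mul, pow_succ w,
      ← mul_assoc, ih, Finset.sum_mul]
    congr 1
    · rw [← mul_assoc, ← mul_pow, hzw]; simp

/-- With z on the unit circle and w its conjugate, this is the triangular-weight expansion of the
squared modulus of a geometric sum, i.e. of the Fejér kernel before division by n + 1. -/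
theorem sum_pow_mul_sum_pow_inv {z w : ℂ} (hzw : z * w = 1) (n : ℕ) :
    (∑ j ∈ Finset.range (n + 1), z ^ j) * (∑ j ∈ Finset.range (n + 1), w ^ j) =
      (n + 1) + ∑ k ∈ Finset.range n, ((n : ℂ) - k) * (z ^ (k + 1) + w ^ (k + 1)) := by
  induction n with
  | zero => simp
  | succ n ih =>
    have h1 := sum_pow_mul_pow_inv hzw n
    have h2 := sum_pow_mul_pow_inv (mul_comm z w ▸ hzw) n
    have h3 : z ^ (n + 1) * w ^ (n + 1) = 1 := by rw [← mul_pow, hzw, one_pow]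
    have h4 : ∑ k ∈ Finset.range (n + 1), (((n + 1 : ℕ) : ℂ) - k) * (z ^ (k + 1) + w ^ (k + 1)) =
        (∑ k ∈ Finset.range n, ((n : ℂ) - k) * (z ^ (k + 1) + w ^ (k + 1))) +
          ∑ k ∈ Finset.range (n + 1), (z ^ (k + 1) + w ^ (k + 1)) := by
      have : ∑ k ∈ Finset.range n, ((n : ℂ) - k) * (z ^ (k + 1) + w ^ (k + 1)) =
          ∑ k ∈ Finset.range (n + 1), ((n : ℂ) - k) * (z ^ (k + 1) + w ^ (k + 1)) := by
        rw [Finset.sum_range_succ]; simp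
      rw [this, ← Finset.sum_add_distrib]
      refine Finset.sum_congr rfl fun k _ => ?_
      push_cast; ring
    rw [h4, Finset.sum_add_distrib, ← h1, ← h2, Finset.sum_range_succ _ (n + 1),
      Finset.sum_range_succ _ (n + 1)]
    push_cast
    linear_combination ih + h3

theorem sum_Icc_neg_eq (f : ℤ → ℂ) (n : ℕ) :
    ∑ k ∈ Finset.Icc (-(n : ℤ)) n, f k =
      f 0 + ∑ k ∈ Finset.range n, (f (k + 1) + f (-(k + 1))) := by
  induction n with
  | zero => simp
  | succ n ih =>
    have : Finset.Icc (-((n + 1 : ℕ) : ℤ)) ((n + 1 : ℕ) : ℤ) =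
        insert ((n : ℤ) + 1) (insert (-((n : ℤ) + 1)) (Finset.Icc (-(n : ℤ)) n)) := by
      ext x
      simp only [Finset.mem_Icc, Finset.mem_insert]
      push_cast
      omega
    rw [this, Finset.sum_insert, Finset.sum_insert, ih, Finset.sum_range_succ]
    · ring
    · simp only [Finset.mem_Icc]; omega
    · simp only [Finset.mem_Icc, Finset.mem_insert]; omega

/-- The Fejér kernel, normalised to have integral `2π` over a period. -/
noncomputable def fejerKernel (n : ℕ) (t : ℝ) : ℝ :=
  ‖∑ j ∈ Finset.range (n + 1), Complex.exp (Complex.I * (t : ℂ)) ^ j‖ ^ 2 / ((n : ℝ) + 1)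

/-- The coefficients of the Fejér kernel. -/
noncomputable def fejerWeight (n : ℕ) (k : ℤ) : ℝ := 1 - |(k : ℝ)| / ((n : ℝ) + 1)

theorem fejerKernel_nonneg (n : ℕ) (t : ℝ) : 0 ≤ fejerKernel n t := by
  unfold fejerKernel; positivity

theorem continuous_fejerKernel (n : ℕ) : Continuous (fejerKernel n) := by
  unfold fejerKernel; fun_prop

theorem fejerKernel_eq_sum (n : ℕ) (t : ℝ) :
    (fejerKernel n t : ℂ) = ∑ k ∈ Finset.Icc (-(n : ℤ)) n,
      (fejerWeight n k : ℂ) * Complex.exp (Complex.I * (k : ℂ) * (t : ℂ)) := by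
  set z := Complex.exp (Complex.I * (t : ℂ)) with hz
  set w := Complex.exp (-(Complex.I * (t : ℂ))) with hw
  have hzw : z * w = 1 := by rw [hz, hw, ← Complex.exp_add, add_neg_cancel, Complex.exp_zero]
  have hconj : (starRingEnd ℂ) z = w := by
    rw [hz, hw, ← Complex.exp_conj]; simp
  have hn : (n : ℂ) + 1 ≠ 0 := by exact_mod_cast n.succ_ne_zero
  have hnorm : ((‖∑ j ∈ Finset.range (n + 1), z ^ j‖ ^ 2 : ℝ) : ℂ) =
      (∑ j ∈ Finset.range (n + 1), z ^ j) * ∑ j ∈ Finset.range (n + 1), w ^ j := by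
    push_cast
    rw [← Complex.mul_conj', map_sum]
    simp only [map_pow, hconj]
  unfold fejerKernel
  rw [Complex.ofReal_div, hnorm, sum_pow_mul_sum_pow_inv hzw, sum_Icc_neg_eq, add_div,
    Finset.sum_div]
  congr 1
  · simp [fejerWeight, hn]
  · refine Finset.sum_congr rfl fun k _ => ?_
    have h1 : fejerWeight n (k + 1) = (n - k) / (n + 1) := by
      have : ((n : ℝ) + 1) ≠ 0 := by positivity
      unfold fejerWeight
      push_cast
      rw [abs_of_nonneg (by positivity)]
      field_simp; ring
    have h2 : fejerWeight n (-(k + 1)) = (n - k) / (n + 1) := by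
      rw [← h1]; unfold fejerWeight; push_cast; rw [abs_neg]
    rw [h1, h2, hz, hw, ← Complex.exp_nat_mul, ← Complex.exp_nat_mul]
    push_cast
    rw [show Complex.I * ((k : ℂ) + 1) * t = ((k : ℂ) + 1) * (Complex.I * t) by ring,
      show Complex.I * (-((k : ℂ) + 1)) * t = ((k : ℂ) + 1) * -(Complex.I * t) by ring]
    ring

theorem periodic_fejerKernel (n : ℕ) : Function.Periodic (fejerKernel n) (2 * Real.pi) := by
  intro t
  have := periodic_exp_int 1 t
  simp only [Int.cast_one, mul_one] at this
  simp only [fejerKernel, this]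

theorem integral_fejerKernel (n : ℕ) :
    ∫ t in (-Real.pi)..Real.pi, fejerKernel n t = 2 * Real.pi := by
  have h : ((∫ t in (-Real.pi)..Real.pi, fejerKernel n t : ℝ) : ℂ) = 2 * (Real.pi : ℂ) := by
    rw [← intervalIntegral.integral_ofReal]
    simp_rw [fejerKernel_eq_sum]
    rw [intervalIntegral.integral_finsetSum fun k _ =>
      ((continuous_exp_int k).const_mul _).intervalIntegrable _ _]
    simp_rw [intervalIntegral.integral_const_mul, integral_exp_int]
    simp [fejerWeight]
  exact_mod_cast h

theorem integral_fejerKernel_period (n : ℕ) (x : ℝ) :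
    ∫ t in x..(x + 2 * Real.pi), fejerKernel n t = 2 * Real.pi := by
  rw [(periodic_fejerKernel n).intervalIntegral_add_eq x (-Real.pi)]
  rw [show -Real.pi + 2 * Real.pi = Real.pi by ring, integral_fejerKernel]

theorem fejerMean_eq_trigPoly (a : ℤ → ℂ) (n : ℕ) :
    fejerMean a n = fun t : ℝ => ∑ k ∈ Finset.Icc (-(n : ℤ)) n,
      (1 / (2 * (Real.pi : ℂ)) * ((fejerWeight n k : ℂ) * a k)) *
        Complex.exp (Complex.I * (k : ℂ) * (t : ℂ)) := by
  funext t
  simp only [fejerMean, Finset.mul_sum, fejerWeight, mul_assoc]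

theorem two_pi_ne_zero_complex : (2 * (Real.pi : ℂ)) ≠ 0 := by
  exact_mod_cast Real.two_pi_pos.ne'

theorem torusFourierCoeff_fejerMean (a : ℤ → ℂ) (n : ℕ) (k : ℤ) :
    torusFourierCoeff (fejerMean a n) k =
      if k ∈ Finset.Icc (-(n : ℤ)) n then (fejerWeight n k : ℂ) * a k else 0 := by
  rw [fejerMean_eq_trigPoly, torusFourierCoeff_trigPoly]
  split_ifs
  · field_simp [two_pi_ne_zero_complex]
  · rfl

theorem tendsto_torusFourierCoeff_fejerMean (a : ℤ → ℂ) (k : ℤ) :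
    Tendsto (fun n : ℕ => torusFourierCoeff (fejerMean a n) k) atTop (𝓝 (a k)) := by
  have h : Tendsto (fun n : ℕ => (fejerWeight n k : ℂ) * a k) atTop (𝓝 (((1 - 0 : ℝ) : ℂ) * a k)) := by
    refine Tendsto.mul_const _ ((Complex.continuous_ofReal.tendsto _).comp ?_)
    refine tendsto_const_nhds.sub ?_
    have := (tendsto_const_div_atTop_nhds_zero_nat |(k : ℝ)|).comp (tendsto_add_atTop_nat 1)
    refine this.congr fun n => ?_
    simp
  simp only [sub_zero, Complex.ofReal_one, one_mul] at h
  refine h.congr' ?_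
  filter_upwards [eventually_ge_atTop k.natAbs] with n hn
  rw [torusFourierCoeff_fejerMean, if_pos]
  rw [Finset.mem_Icc]; omega

theorem periodic_fejerMean (a : ℤ → ℂ) (n : ℕ) :
    Function.Periodic (fejerMean a n) (2 * Real.pi) := by
  intro t
  simp only [fejerMean]
  congr 1
  refine Finset.sum_congr rfl fun k _ => ?_
  have := periodic_exp_int k t
  simp only at this
  rw [this]

theorem contDiff_fejerMean (a : ℤ → ℂ) (n : ℕ) : ContDiff ℝ 1 (fejerMean a n) := by
  unfold fejerMean
  have : ContDiff ℝ 1 (fun t : ℝ => (t : ℂ)) := Complex.ofRealCLM.contDiff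
  fun_prop

theorem boundedVariationOn_fejerMean (a : ℤ → ℂ) (n : ℕ) (x y : ℝ) :
    BoundedVariationOn (fejerMean a n) (Icc x y) := by
  rcases lt_or_ge y x with h | h
  · simp [Icc_eq_empty (not_le.2 h), BoundedVariationOn]
  obtain ⟨K, hK⟩ := (contDiff_fejerMean a n).contDiffOn.exists_lipschitzOnWith one_ne_zero
    (convex_Icc x y) isCompact_Icc
  have := hK.locallyBoundedVariationOn x y ⟨le_rfl, h⟩ ⟨h, le_rfl⟩
  rwa [inter_self] at this

/-! ### Fejér means of functions of bounded variation -/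

theorem Function.Periodic.eVariationOn_add {u : ℝ → ℝ} {c : ℝ} (hu : Function.Periodic u c)
    (a b : ℝ) : eVariationOn u (Icc (a + c) (b + c)) = eVariationOn u (Icc a b) := by
  have h := eVariationOn.comp_eq_of_monotoneOn u (t := Icc a b) (fun x => x + c)
    (fun x _ y _ hxy => by simpa using hxy)
  rw [image_add_const_Icc] at h
  rw [← h]
  exact eVariationOn.eq_of_eqOn fun x _ => hu x

theorem eVariationOn_Icc_add_Icc (u : ℝ → ℝ) {a b c : ℝ} (hab : a ≤ b) (hbc : b ≤ c) :
    eVariationOn u (Icc a b) + eVariationOn u (Icc b c) = eVariationOn u (Icc a c) := by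
  simpa using eVariationOn.Icc_add_Icc u (s := univ) hab hbc (mem_univ b)

/-- The variation of a periodic function over a period does not depend on the period chosen. -/
theorem Function.Periodic.eVariationOn_period {u : ℝ → ℝ} {T : ℝ} (hT : 0 < T)
    (hu : Function.Periodic u T) (a x : ℝ) :
    eVariationOn u (Icc x (x + T)) = eVariationOn u (Icc a (a + T)) := by
  -- Translate x to y in [a, a + T), cut [y, y + T] at a + T, and move the right piece back by T
  -- onto [a, y].
  obtain ⟨k, ⟨hk1, hk2⟩, -⟩ := existsUnique_add_zsmul_mem_Ico hT x a
  have hper : Function.Periodic u (k • T) := hu.zsmul k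
  rw [← hper.eVariationOn_add x (x + T)]
  set y := x + k • T
  rw [show x + T + k • T = y + T by simp only [y]; ring,
    ← eVariationOn_Icc_add_Icc u hk2.le (show a + T ≤ y + T by linarith), hu.eVariationOn_add,
    add_comm, eVariationOn_Icc_add_Icc u hk1 hk2.le]

/-- The normalised convolution of `u` with the Fejér kernel. -/
noncomputable def fejerConv (n : ℕ) (u : ℝ → ℝ) (t : ℝ) : ℝ :=
  1 / (2 * Real.pi) * ∫ r in (-Real.pi)..Real.pi, fejerKernel n r * u (t - r)

theorem Function.Periodic.eVariationOn_window {u : ℝ → ℝ}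
    (hu : Function.Periodic u (2 * Real.pi)) (x : ℝ) :
    eVariationOn u (Icc (x - Real.pi) (x + Real.pi)) =
      eVariationOn u (Icc (-Real.pi) Real.pi) := by
  have := hu.eVariationOn_period Real.two_pi_pos (-Real.pi) (x - Real.pi)
  rwa [show x - Real.pi + 2 * Real.pi = x + Real.pi by ring,
    show -Real.pi + 2 * Real.pi = Real.pi by ring] at this

theorem BoundedVariationOn.intervalIntegrable_translate {u : ℝ → ℝ}
    (hbv : BoundedVariationOn u (Icc (-Real.pi) Real.pi))
    (hu : Function.Periodic u (2 * Real.pi)) (t : ℝ) :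
    IntervalIntegrable (fun r => u (t - r)) MeasureTheory.volume (-Real.pi) Real.pi := by
  have h : BoundedVariationOn u (Icc (t - Real.pi) (t + Real.pi)) := by
    rw [BoundedVariationOn, hu.eVariationOn_window]; exact hbv
  have h2 := (h.intervalIntegrable_real (by linarith [Real.pi_pos])).comp_sub_left t
  simpa using h2.symm

/-- For a fixed partition, the variation sum of the convolution is at most the kernel average of the
variation sums of the translates of u. Each of these is at most the variation of u over a period. -/
theorem eVariationOn_fejerConv_le (n : ℕ) {u : ℝ → ℝ}
    (hbv : BoundedVariationOn u (Icc (-Real.pi) Real.pi))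
    (hu : Function.Periodic u (2 * Real.pi)) :
    eVariationOn (fejerConv n u) (Icc (-Real.pi) Real.pi) ≤
      eVariationOn u (Icc (-Real.pi) Real.pi) := by
  have hpi := Real.pi_pos
  have hle : -Real.pi ≤ Real.pi := by linarith
  set V := (eVariationOn u (Icc (-Real.pi) Real.pi)).toReal with hV
  have hint : ∀ t, IntervalIntegrable (fun r => fejerKernel n r * u (t - r))
      MeasureTheory.volume (-Real.pi) Real.pi := fun t =>
    (hbv.intervalIntegrable_translate hu t).continuousOn_mul
      (continuous_fejerKernel n).continuousOn
  have hintd : ∀ s t, IntervalIntegrable (fun r => fejerKernel n r * |u (s - r) - u (t - r)|)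
      MeasureTheory.volume (-Real.pi) Real.pi := fun s t =>
    ((hbv.intervalIntegrable_translate hu s).sub
      (hbv.intervalIntegrable_translate hu t)).abs.continuousOn_mul
      (continuous_fejerKernel n).continuousOn
  refine iSup_le fun ⟨N, s, hs, hmem⟩ => ?_
  -- The translated partition lies in another window of length 2π, over which u has the same
  -- variation.
  have hsum : ∀ r, ∑ i ∈ Finset.range N, |u (s (i + 1) - r) - u (s i - r)| ≤ V := by
    intro r
    have hw : eVariationOn u (Icc (-r - Real.pi) (-r + Real.pi)) ≤ ENNReal.ofReal V := by
      rw [hu.eVariationOn_window, hV, ENNReal.ofReal_toReal hbv]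
    have h := (eVariationOn.sum_le (f := u) (s := Icc (-r - Real.pi) (-r + Real.pi)) (n := N)
      (u := fun i => s i - r) (fun i j hij => by simpa using hs hij)
      (fun i => ⟨by linarith [(hmem i).1], by linarith [(hmem i).2]⟩)).trans hw
    simp_rw [edist_dist, Real.dist_eq] at h
    rw [← ENNReal.ofReal_sum_of_nonneg (fun _ _ => abs_nonneg _)] at h
    exact (ENNReal.ofReal_le_ofReal_iff ENNReal.toReal_nonneg).1 h
  have hpiece : ∀ x y, |fejerConv n u x - fejerConv n u y| ≤ 1 / (2 * Real.pi) *
      ∫ r in (-Real.pi)..Real.pi, fejerKernel n r * |u (x - r) - u (y - r)| := by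
    intro x y
    rw [fejerConv, fejerConv, ← mul_sub, ← intervalIntegral.integral_sub (hint x) (hint y),
      abs_mul, abs_of_nonneg (by positivity : 0 ≤ 1 / (2 * Real.pi))]
    refine mul_le_mul_of_nonneg_left ?_ (by positivity)
    refine (intervalIntegral.abs_integral_le_integral_abs hle).trans (le_of_eq ?_)
    refine intervalIntegral.integral_congr fun r _ => ?_
    rw [← mul_sub, abs_mul, abs_of_nonneg (fejerKernel_nonneg n r)]
  simp_rw [edist_dist, Real.dist_eq]
  rw [← ENNReal.ofReal_sum_of_nonneg (fun _ _ => abs_nonneg _), ← ENNReal.ofReal_toReal hbv]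
  refine ENNReal.ofReal_le_ofReal ((Finset.sum_le_sum fun i _ => hpiece _ _).trans ?_)
  rw [← Finset.mul_sum, ← intervalIntegral.integral_finsetSum fun i _ => hintd _ _]
  simp_rw [← Finset.mul_sum]
  have h1 : (∫ r in (-Real.pi)..Real.pi, fejerKernel n r *
      ∑ i ∈ Finset.range N, |u (s (i + 1) - r) - u (s i - r)|) ≤
      ∫ r in (-Real.pi)..Real.pi, fejerKernel n r * V := by
    refine intervalIntegral.integral_mono_on hle ?_ ?_ fun r _ =>
      mul_le_mul_of_nonneg_left (hsum r) (fejerKernel_nonneg n r)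
    · simp_rw [Finset.mul_sum]
      rw [intervalIntegrable_iff]
      exact MeasureTheory.integrable_finsetSum _ fun i _ =>
        intervalIntegrable_iff.1 (hintd (s (i + 1)) (s i))
    · exact ((continuous_fejerKernel n).mul continuous_const).intervalIntegrable _ _
  rw [intervalIntegral.integral_mul_const, integral_fejerKernel] at h1
  calc _ ≤ 1 / (2 * Real.pi) * (2 * Real.pi * V) := mul_le_mul_of_nonneg_left h1 (by positivity)
    _ = V := by field_simp

theorem MemBV.boundedVariationOn {g : ℝ → ℂ} (hg : MemBV g) :
    BoundedVariationOn g (Icc (-Real.pi) Real.pi) :=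
  ne_top_of_le_ne_top (ENNReal.add_ne_top.2 ⟨hg.2.1, hg.2.2⟩) (eVariationOn_le_re_add_im g _)

theorem MemBV.periodic_re {g : ℝ → ℂ} (hg : MemBV g) :
    Function.Periodic (fun t => (g t).re) (2 * Real.pi) := fun t => congrArg Complex.re (hg.1 t)

theorem MemBV.periodic_im {g : ℝ → ℂ} (hg : MemBV g) :
    Function.Periodic (fun t => (g t).im) (2 * Real.pi) := fun t => congrArg Complex.im (hg.1 t)

/-- Reflection and periodicity put the translate on the kernel; expanding the kernel in exponentials
then produces the coefficients of g. -/
theorem fejerMean_torusFourierCoeff {g : ℝ → ℂ} (hg : MemBV g) (n : ℕ) (t : ℝ) :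
    fejerMean (torusFourierCoeff g) n t = 1 / (2 * (Real.pi : ℂ)) *
      ∫ r in (-Real.pi)..Real.pi, (fejerKernel n r : ℂ) * g (t - r) := by
  have hpi := Real.pi_pos
  have hint := hg.boundedVariationOn.intervalIntegrable_complex (by linarith)
  set h : ℝ → ℂ := fun s => (fejerKernel n (t - s) : ℂ) * g s with hh
  have hper : Function.Periodic h (2 * Real.pi) := by
    intro s
    have h1 := (periodic_fejerKernel n).sub_eq (t - s)
    simp only [hh, hg.1 s]
    rw [show t - (s + 2 * Real.pi) = t - s - 2 * Real.pi by ring, h1]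
  have hshift : (∫ r in (-Real.pi)..Real.pi, (fejerKernel n r : ℂ) * g (t - r)) =
      ∫ s in (-Real.pi)..Real.pi, h s := by
    have e1 : ∀ r, (fejerKernel n r : ℂ) * g (t - r) = h (t - r) := fun r => by
      simp only [hh, sub_sub_cancel]
    simp_rw [e1]
    rw [intervalIntegral.integral_comp_sub_left h t]
    have := hper.intervalIntegral_add_eq (t - Real.pi) (-Real.pi)
    rwa [show t - Real.pi + 2 * Real.pi = t - -Real.pi by ring,
      show -Real.pi + 2 * Real.pi = Real.pi by ring] at this
  rw [hshift, fejerMean]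
  congr 1
  have e2 : ∀ s, h s = ∑ k ∈ Finset.Icc (-(n : ℤ)) n, (fejerWeight n k : ℂ) *
      Complex.exp (Complex.I * k * t) * (g s * Complex.exp (-(Complex.I * k * s))) := by
    intro s
    simp only [hh]
    rw [fejerKernel_eq_sum, Finset.sum_mul]
    refine Finset.sum_congr rfl fun k _ => ?_
    rw [show Complex.I * (k : ℂ) * ((t - s : ℝ) : ℂ) =
      Complex.I * k * t + -(Complex.I * k * s) by push_cast; ring, Complex.exp_add]
    ring
  simp_rw [e2]
  rw [intervalIntegral.integral_finsetSum fun k _ =>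
    (hint.mul_continuousOn (by fun_prop)).const_mul _]
  refine Finset.sum_congr rfl fun k _ => ?_
  rw [intervalIntegral.integral_const_mul, torusFourierCoeff, fejerWeight]
  ring

theorem MemBV.intervalIntegrable_kernel {g : ℝ → ℂ} (hg : MemBV g) (n : ℕ) (t : ℝ) :
    IntervalIntegrable (fun r => (fejerKernel n r : ℂ) * g (t - r)) MeasureTheory.volume
      (-Real.pi) Real.pi := by
  have h1 := hg.2.1.intervalIntegrable_translate hg.periodic_re t
  have h2 := hg.2.2.intervalIntegrable_translate hg.periodic_im t
  have h3 : IntervalIntegrable (fun r => g (t - r)) MeasureTheory.volume (-Real.pi) Real.pi := by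
    rw [intervalIntegrable_iff] at h1 h2 ⊢
    refine ((h1.ofReal (𝕜 := ℂ)).add ((h2.ofReal (𝕜 := ℂ)).mul_const Complex.I)).congr
      (Eventually.of_forall fun r => ?_)
    simp [Complex.re_add_im]
  exact h3.continuousOn_mul
    (Complex.continuous_ofReal.comp (continuous_fejerKernel n)).continuousOn

theorem fejerMean_torusFourierCoeff_re {g : ℝ → ℂ} (hg : MemBV g) (n : ℕ) :
    (fun t => (fejerMean (torusFourierCoeff g) n t).re) =
      fejerConv n fun t => (g t).re := by
  funext t
  have h := Complex.reCLM.intervalIntegral_comp_comm (hg.intervalIntegrable_kernel n t)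
  simp only [Complex.reCLM_apply, Complex.re_ofReal_mul] at h
  rw [fejerMean_torusFourierCoeff hg, fejerConv, h,
    show 1 / (2 * (Real.pi : ℂ)) = ((1 / (2 * Real.pi) : ℝ) : ℂ) by push_cast; rfl,
    Complex.re_ofReal_mul]

theorem fejerMean_torusFourierCoeff_im {g : ℝ → ℂ} (hg : MemBV g) (n : ℕ) :
    (fun t => (fejerMean (torusFourierCoeff g) n t).im) =
      fejerConv n fun t => (g t).im := by
  funext t
  have h := Complex.imCLM.intervalIntegral_comp_comm (hg.intervalIntegrable_kernel n t)
  simp only [Complex.imCLM_apply, Complex.im_ofReal_mul] at h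
  rw [fejerMean_torusFourierCoeff hg, fejerConv, h,
    show 1 / (2 * (Real.pi : ℂ)) = ((1 / (2 * Real.pi) : ℝ) : ℂ) by push_cast; rfl,
    Complex.im_ofReal_mul]

/-- A real `⨆` of an unbounded family defaults to 0, so boundedness is what makes the sup term of
`bvNorm` dominate the values of g. -/
theorem bddAbove_norm_of_periodic {g : ℝ → ℂ} (hper : Function.Periodic g (2 * Real.pi))
    (hbv : BoundedVariationOn g (Icc (-Real.pi) Real.pi)) :
    BddAbove (range fun t => ‖g t‖) := by
  have hpi := Real.pi_pos
  refine ⟨(eVariationOn g (Icc (-Real.pi) Real.pi)).toReal + ‖g 0‖, ?_⟩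
  rintro _ ⟨t, rfl⟩
  obtain ⟨s, hs, hst⟩ := hper.exists_mem_Ico Real.two_pi_pos t (-Real.pi)
  have h := hbv.dist_le (x := s) (y := 0) ⟨hs.1, by linarith [hs.2]⟩ ⟨by linarith, hpi.le⟩
  rw [dist_eq_norm] at h
  simp only [hst]
  linarith [norm_le_norm_sub_add (g s) (g 0)]

theorem MemBV.norm_le {g : ℝ → ℂ} (hg : MemBV g) (t : ℝ) : ‖g t‖ ≤ ⨆ s, ‖g s‖ :=
  le_ciSup (bddAbove_norm_of_periodic hg.1 hg.boundedVariationOn) t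

theorem norm_fejerMean_torusFourierCoeff_le {g : ℝ → ℂ} (hg : MemBV g) (n : ℕ) (t : ℝ) :
    ‖fejerMean (torusFourierCoeff g) n t‖ ≤ ⨆ s, ‖g s‖ := by
  have hpi := Real.pi_pos
  set S := ⨆ s, ‖g s‖
  have h1 : ‖∫ r in (-Real.pi)..Real.pi, (fejerKernel n r : ℂ) * g (t - r)‖ ≤
      ∫ r in (-Real.pi)..Real.pi, fejerKernel n r * S := by
    refine intervalIntegral.norm_integral_le_of_norm_le (by linarith) ?_
      (((continuous_fejerKernel n).mul continuous_const).intervalIntegrable _ _)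
    refine Eventually.of_forall fun r _ => ?_
    rw [norm_mul, Complex.norm_of_nonneg (fejerKernel_nonneg n r)]
    exact mul_le_mul_of_nonneg_left (hg.norm_le _) (fejerKernel_nonneg n r)
  rw [intervalIntegral.integral_mul_const, integral_fejerKernel] at h1
  rw [fejerMean_torusFourierCoeff hg, norm_mul,
    show 1 / (2 * (Real.pi : ℂ)) = ((1 / (2 * Real.pi) : ℝ) : ℂ) by push_cast; rfl,
    Complex.norm_of_nonneg (by positivity)]
  calc _ ≤ 1 / (2 * Real.pi) * (2 * Real.pi * S) := mul_le_mul_of_nonneg_left h1 (by positivity)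
    _ = S := by field_simp

theorem bvNorm_fejerMean_torusFourierCoeff_le {g : ℝ → ℂ} (hg : MemBV g) (n : ℕ) :
    bvNorm (fejerMean (torusFourierCoeff g) n) ≤ bvNorm g := by
  unfold bvNorm torusVar
  rw [fejerMean_torusFourierCoeff_re hg, fejerMean_torusFourierCoeff_im hg]
  have h1 := ENNReal.toReal_mono hg.2.1 (eVariationOn_fejerConv_le n hg.2.1 hg.periodic_re)
  have h2 := ENNReal.toReal_mono hg.2.2 (eVariationOn_fejerConv_le n hg.2.2 hg.periodic_im)
  refine add_le_add (ciSup_le (norm_fejerMean_torusFourierCoeff_le hg n)) (Real.sqrt_le_sqrt ?_)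
  gcongr

/-! ### The Alexiewicz norm and the pairing -/

theorem IsTrigPoly.continuous {p : ℝ → ℂ} (hp : IsTrigPoly p) : Continuous p := by
  obtain ⟨s, b, rfl⟩ := hp
  fun_prop

theorem IsTrigPoly.exists_norm_le {p : ℝ → ℂ} (hp : IsTrigPoly p) : ∃ M, ∀ t, ‖p t‖ ≤ M := by
  obtain ⟨s, b, rfl⟩ := hp
  refine ⟨∑ k ∈ s, ‖b k‖, fun t => norm_sum_le_of_le _ fun k _ => ?_⟩
  rw [norm_mul, norm_exp_int, mul_one]

theorem norm_integral_le_alexiewiczNorm {p : ℝ → ℂ} {M : ℝ} (hM : ∀ t, ‖p t‖ ≤ M) {α β : ℝ}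
    (hαβ : α ≤ β) (hlen : β - α ≤ 2 * Real.pi) : ‖∫ t in α..β, p t‖ ≤ alexiewiczNorm p := by
  have hM0 : 0 ≤ M := (norm_nonneg _).trans (hM 0)
  refine le_csSup ⟨M * (2 * Real.pi), ?_⟩ ⟨α, β, hαβ, hlen, rfl⟩
  rintro _ ⟨x, y, hxy, hl, rfl⟩
  refine (intervalIntegral.norm_integral_le_of_norm_le_const fun t _ => hM t).trans ?_
  rw [abs_of_nonneg (sub_nonneg.2 hxy)]
  exact mul_le_mul_of_nonneg_left hl hM0

theorem alexiewiczNorm_le {p : ℝ → ℂ} {B : ℝ}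
    (hB : ∀ α β, α ≤ β → β - α ≤ 2 * Real.pi → ‖∫ t in α..β, p t‖ ≤ B) :
    alexiewiczNorm p ≤ B := by
  refine csSup_le ⟨_, 0, 0, le_rfl, by simpa using Real.pi_pos.le, rfl⟩ ?_
  rintro _ ⟨x, y, hxy, hl, rfl⟩
  exact hB x y hxy hl

theorem ContinuousOn.exists_midrange {f : ℝ → ℝ} {a b D : ℝ} (hab : a ≤ b)
    (hf : ContinuousOn f (Icc a b)) (hD : ∀ x ∈ Icc a b, ∀ y ∈ Icc a b, |f x - f y| ≤ D) :
    ∃ c, ∀ x ∈ Icc a b, |f x - c| ≤ D / 2 := by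
  obtain ⟨x, hx, hmin⟩ := isCompact_Icc.exists_isMinOn (nonempty_Icc.2 hab) hf
  obtain ⟨y, hy, hmax⟩ := isCompact_Icc.exists_isMaxOn (nonempty_Icc.2 hab) hf
  refine ⟨(f x + f y) / 2, fun z hz => ?_⟩
  have h1 : f x ≤ f z := hmin hz
  have h2 : f z ≤ f y := hmax hz
  have h3 := (le_abs_self _).trans (hD y hy x hx)
  rw [abs_le]
  constructor <;> linarith

/-- A planar curve of diameter `D` lies in a disc of radius `D / √2`. -/
theorem ContinuousOn.exists_center {Q : ℝ → ℂ} {a b D : ℝ} (hab : a ≤ b)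
    (hQ : ContinuousOn Q (Icc a b)) (hD : ∀ x ∈ Icc a b, ∀ y ∈ Icc a b, ‖Q x - Q y‖ ≤ D) :
    ∃ c, ∀ x ∈ Icc a b, ‖Q x - c‖ ≤ D / Real.sqrt 2 := by
  have hD0 : 0 ≤ D := (norm_nonneg _).trans (hD a ⟨le_rfl, hab⟩ a ⟨le_rfl, hab⟩)
  obtain ⟨c, hc⟩ := (Complex.continuous_re.comp_continuousOn hQ).exists_midrange hab
    (D := D) fun x hx y hy => by
      simpa using (Complex.abs_re_le_norm (Q x - Q y)).trans (hD x hx y hy)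
  obtain ⟨d, hd⟩ := (Complex.continuous_im.comp_continuousOn hQ).exists_midrange hab
    (D := D) fun x hx y hy => by
      simpa using (Complex.abs_im_le_norm (Q x - Q y)).trans (hD x hx y hy)
  -- The curve lies in a square of side D about this point, whose half-diagonal is D/√2.
  refine ⟨⟨c, d⟩, fun x hx => ?_⟩
  have h1 := abs_le.1 (hc x hx)
  have h2 := abs_le.1 (hd x hx)
  simp only [Function.comp_apply] at h1 h2
  refine abs_le_of_sq_le_sq' ?_ (by positivity) |>.2
  rw [Complex.sq_norm, Complex.normSq_apply, div_pow, Real.sq_sqrt (by norm_num)]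
  simp only [Complex.sub_re, Complex.sub_im]
  nlinarith

theorem eVariationOn_conj (g : ℝ → ℂ) (s : Set ℝ) :
    eVariationOn (fun t => (starRingEnd ℂ) (g t)) s = eVariationOn g s := by
  simp only [eVariationOn, edist_dist, dist_eq_norm, ← map_sub, Complex.norm_conj]

/-- A Parseval identity; the factor 2π comes from the unnormalised coefficients and is the one in
the bound 2πc. -/
theorem sum_mul_conj_torusFourierCoeff {g : ℝ → ℂ} (hg : MemBV g) (s : Finset ℤ) (b : ℤ → ℂ) :
    ∑ k ∈ s, 2 * (Real.pi : ℂ) * b k * (starRingEnd ℂ) (torusFourierCoeff g k) =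
      2 * (Real.pi : ℂ) * ∫ t in (-Real.pi)..Real.pi,
        (∑ k ∈ s, b k * Complex.exp (Complex.I * (k : ℂ) * (t : ℂ))) * (starRingEnd ℂ) (g t) := by
  have hle : -Real.pi ≤ Real.pi := by linarith [Real.pi_pos]
  have hconj : BoundedVariationOn (fun t => (starRingEnd ℂ) (g t)) (Icc (-Real.pi) Real.pi) := by
    rw [BoundedVariationOn, eVariationOn_conj]; exact hg.boundedVariationOn
  have hint := hconj.intervalIntegrable_complex hle
  simp_rw [Finset.sum_mul]
  rw [intervalIntegral.integral_finsetSum fun k _ =>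
    hint.continuousOn_mul ((continuous_exp_int k).const_mul (b k)).continuousOn, Finset.mul_sum]
  refine Finset.sum_congr rfl fun k _ => ?_
  have h := (Complex.conjCLE : ℂ →L[ℝ] ℂ).intervalIntegral_comp_comm
    ((hg.boundedVariationOn.intervalIntegrable_complex hle).mul_continuousOn
      (g := fun t : ℝ => Complex.exp (-(Complex.I * (k : ℂ) * (t : ℂ)))) (by fun_prop))
  simp only [ContinuousLinearEquiv.coe_coe, Complex.conjCLE_apply] at h
  rw [torusFourierCoeff, ← h, mul_assoc, ← intervalIntegral.integral_const_mul]
  congr 1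
  refine intervalIntegral.integral_congr fun t _ => ?_
  simp only [map_mul, ← Complex.exp_conj, map_neg, Complex.conj_I, Complex.conj_ofReal,
    map_intCast]
  ring_nf

theorem add_le_sqrt_two_mul_sqrt {x y : ℝ} :
    x + y ≤ Real.sqrt 2 * Real.sqrt (x ^ 2 + y ^ 2) := by
  rw [← Real.sqrt_mul (by norm_num)]
  exact Real.le_sqrt_of_sq_le (by nlinarith [sq_nonneg (x - y)])

/-- Integration by parts, with the primitive of p recentred at the middle of a square containing its
curve. -/
theorem norm_integral_mul_conj_le {g p : ℝ → ℂ} (hg : MemBV g) (hp : IsTrigPoly p) :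
    ‖∫ t in (-Real.pi)..Real.pi, p t * (starRingEnd ℂ) (g t)‖ ≤
      alexiewiczNorm p * bvNorm g := by
  have hpi := Real.pi_pos
  have hle : -Real.pi ≤ Real.pi := by linarith
  obtain ⟨M, hM⟩ := hp.exists_norm_le
  set D := alexiewiczNorm p
  have hDx : ∀ x ∈ Icc (-Real.pi) Real.pi, ∀ y ∈ Icc (-Real.pi) Real.pi,
      ‖(∫ t in (-Real.pi)..x, p t) - ∫ t in (-Real.pi)..y, p t‖ ≤ D := by
    intro x hx y hy
    rw [intervalIntegral.integral_interval_sub_left (hp.continuous.intervalIntegrable _ _)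
      (hp.continuous.intervalIntegrable _ _)]
    rcases le_total y x with h | h
    · exact norm_integral_le_alexiewiczNorm hM h (by linarith [hx.2, hy.1])
    · rw [intervalIntegral.integral_symm, norm_neg]
      exact norm_integral_le_alexiewiczNorm hM h (by linarith [hy.2, hx.1])
  obtain ⟨c, hc⟩ := ContinuousOn.exists_center hle
    (intervalIntegral.continuous_primitive (fun a b => hp.continuous.intervalIntegrable a b)
      (-Real.pi)).continuousOn hDx
  set A := torusVar fun t => (g t).re with hA
  set B := torusVar fun t => (g t).im with hB
  have hA0 : 0 ≤ A := ENNReal.toReal_nonneg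
  have hB0 : 0 ≤ B := ENNReal.toReal_nonneg
  have hvar : eVariationOn (fun t => (starRingEnd ℂ) (g t)) (Icc (-Real.pi) Real.pi) ≤
      ENNReal.ofReal (A + B) := by
    rw [eVariationOn_conj, ENNReal.ofReal_add hA0 hB0, hA, hB, torusVar, torusVar,
      ENNReal.ofReal_toReal hg.2.1, ENNReal.ofReal_toReal hg.2.2]
    exact eVariationOn_le_re_add_im _ _
  have hends : (starRingEnd ℂ) (g (-Real.pi)) = (starRingEnd ℂ) (g Real.pi) := by
    have := hg.1 (-Real.pi)
    rw [show -Real.pi + 2 * Real.pi = Real.pi by ring] at this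
    rw [this]
  have h := norm_integral_mul_le_of_eVariationOn_le c hle hp.continuous hM (by positivity)
    hvar hends hc
  have hD0 : 0 ≤ D := (norm_nonneg _).trans
    (norm_integral_le_alexiewiczNorm hM (le_refl 0) (by linarith))
  have h1 : ‖∫ t in (-Real.pi)..Real.pi, p t‖ * ‖(starRingEnd ℂ) (g Real.pi)‖ ≤
      D * ⨆ t, ‖g t‖ := by
    rw [Complex.norm_conj]
    exact mul_le_mul (norm_integral_le_alexiewiczNorm hM hle (by linarith)) (hg.norm_le _)
      (norm_nonneg _) hD0
  -- The √2 lost in A + B ≤ √2·√(A² + B²) is the one gained by recentring.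
  have h2 : D / Real.sqrt 2 * (A + B) ≤ D * Real.sqrt (A ^ 2 + B ^ 2) := by
    have h3 : (0 : ℝ) < Real.sqrt 2 := by positivity
    calc _ ≤ D / Real.sqrt 2 * (Real.sqrt 2 * Real.sqrt (A ^ 2 + B ^ 2)) :=
          mul_le_mul_of_nonneg_left add_le_sqrt_two_mul_sqrt (by positivity)
      _ = _ := by field_simp
  rw [bvNorm, mul_add]
  linarith

theorem IsBVCoeff.pairingBound {a : ℤ → ℂ} {c : ℝ} (h : IsBVCoeff a c) :
    PairingBound a (2 * Real.pi * c) := by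
  obtain ⟨g, hg, hc, ha⟩ := h
  obtain rfl : torusFourierCoeff g = a := funext ha
  intro p hp
  have hpair := norm_integral_mul_conj_le hg hp
  obtain ⟨M, hM⟩ := hp.exists_norm_le
  have hD0 : 0 ≤ alexiewiczNorm p := (norm_nonneg _).trans
    (norm_integral_le_alexiewiczNorm hM (le_refl 0) (by linarith [Real.pi_pos]))
  obtain ⟨s, b, rfl⟩ := hp
  rw [tsum_torusFourierCoeff_trigPoly, sum_mul_conj_torusFourierCoeff hg, norm_mul,
    show (2 * (Real.pi : ℂ)) = ((2 * Real.pi : ℝ) : ℂ) by push_cast; rfl,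
    Complex.norm_of_nonneg Real.two_pi_pos.le, mul_assoc (2 * Real.pi), mul_comm c]
  exact mul_le_mul_of_nonneg_left (hpair.trans (mul_le_mul_of_nonneg_left hc hD0))
    Real.two_pi_pos.le

/-! ### Bounds for the Fejér means from the pairing -/

/-- A primitive of the Fejér kernel. -/
noncomputable def fejerPrimitive (n : ℕ) (x : ℝ) : ℝ := ∫ t in (0 : ℝ)..x, fejerKernel n t

theorem fejerPrimitive_sub (n : ℕ) (x y : ℝ) :
    fejerPrimitive n y - fejerPrimitive n x = ∫ t in x..y, fejerKernel n t :=
  intervalIntegral.integral_interval_sub_left ((continuous_fejerKernel n).intervalIntegrable _ _)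
    ((continuous_fejerKernel n).intervalIntegrable _ _)

theorem fejerPrimitive_monotone (n : ℕ) : Monotone (fejerPrimitive n) := fun x y hxy => by
  rw [← sub_nonneg, fejerPrimitive_sub]
  exact intervalIntegral.integral_nonneg hxy fun t _ => fejerKernel_nonneg n t

theorem fejerPrimitive_sub_le (n : ℕ) {x y : ℝ} (hxy : y - x ≤ 2 * Real.pi) :
    fejerPrimitive n y - fejerPrimitive n x ≤ 2 * Real.pi := by
  have h1 := fejerPrimitive_monotone n (show y ≤ x + 2 * Real.pi by linarith)
  have h2 := fejerPrimitive_sub n x (x + 2 * Real.pi)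
  rw [integral_fejerKernel_period] at h2
  linarith

/-- A linear combination of translates of the Fejér kernel. -/
noncomputable def fejerComb {ι : Type*} (n : ℕ) (s : Finset ι) (η : ι → ℂ) (x : ι → ℝ) (t : ℝ) :
    ℂ :=
  ∑ i ∈ s, η i / (4 * (Real.pi : ℂ) ^ 2) * (fejerKernel n (t - x i) : ℂ)

theorem fejerComb_eq_trigPoly {ι : Type*} (n : ℕ) (s : Finset ι) (η : ι → ℂ) (x : ι → ℝ) :
    fejerComb n s η x = fun t : ℝ => ∑ k ∈ Finset.Icc (-(n : ℤ)) n,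
      (∑ i ∈ s, η i / (4 * (Real.pi : ℂ) ^ 2) * ((fejerWeight n k : ℂ) *
        Complex.exp (-(Complex.I * (k : ℂ) * (x i : ℂ))))) *
        Complex.exp (Complex.I * (k : ℂ) * (t : ℂ)) := by
  funext t
  simp only [fejerComb, fejerKernel_eq_sum, Finset.mul_sum, Finset.sum_mul]
  rw [Finset.sum_comm]
  refine Finset.sum_congr rfl fun k _ => Finset.sum_congr rfl fun i _ => ?_
  rw [show Complex.I * (k : ℂ) * ((t - x i : ℝ) : ℂ) =
    Complex.I * k * t + -(Complex.I * k * x i) by push_cast; ring, Complex.exp_add]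
  ring

/-- Pairing with a kernel translate evaluates the Fejér mean. The divisor 4π² in `fejerComb` is one
2π from the unnormalised coefficients times the 2π in the definition of the mean. -/
theorem PairingBound.norm_sum_fejerMean_le {ι : Type*} {a : ℤ → ℂ} {c : ℝ}
    (h : PairingBound a c) (n : ℕ) (s : Finset ι) (η : ι → ℂ) (x : ι → ℝ) :
    ‖∑ i ∈ s, η i * (starRingEnd ℂ) (fejerMean a n (x i))‖ ≤
      c * alexiewiczNorm (fejerComb n s η x) := by
  have h1 := h (fejerComb n s η x) ⟨_, _, fejerComb_eq_trigPoly n s η x⟩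
  refine le_of_eq_of_le (congrArg _ ?_) h1
  rw [fejerComb_eq_trigPoly, tsum_torusFourierCoeff_trigPoly, fejerMean_eq_trigPoly]
  simp only [map_sum, Finset.mul_sum, Finset.sum_mul]
  rw [Finset.sum_comm]
  refine Finset.sum_congr rfl fun k _ => Finset.sum_congr rfl fun i _ => ?_
  simp only [map_mul, map_div₀, map_one, map_ofNat, ← Complex.exp_conj, Complex.conj_I,
    Complex.conj_ofReal, map_intCast]
  rw [show -Complex.I * (k : ℂ) * (x i : ℂ) = -(Complex.I * k * x i) by ring]
  have : (Real.pi : ℂ) ≠ 0 := by exact_mod_cast Real.pi_ne_zero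
  field_simp
  ring

theorem integral_fejerComb {ι : Type*} (n : ℕ) (s : Finset ι) (η : ι → ℂ) (x : ι → ℝ)
    (α β : ℝ) :
    ∫ t in α..β, fejerComb n s η x t = ∑ i ∈ s, η i / (4 * (Real.pi : ℂ) ^ 2) *
      ((fejerPrimitive n (β - x i) - fejerPrimitive n (α - x i) : ℝ) : ℂ) := by
  unfold fejerComb
  have hc : ∀ i, Continuous fun t : ℝ => (fejerKernel n (t - x i) : ℂ) := fun i =>
    Complex.continuous_ofReal.comp ((continuous_fejerKernel n).comp (continuous_sub_right _))
  rw [intervalIntegral.integral_finsetSum fun i _ =>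
    ((hc i).const_mul _).intervalIntegrable _ _]
  refine Finset.sum_congr rfl fun i _ => ?_
  rw [intervalIntegral.integral_const_mul, intervalIntegral.integral_ofReal,
    intervalIntegral.integral_comp_sub_right (fejerKernel n), fejerPrimitive_sub]

theorem norm_four_pi_sq : ‖(4 * (Real.pi : ℂ) ^ 2)‖ = 4 * Real.pi ^ 2 := by
  rw [show (4 * (Real.pi : ℂ) ^ 2) = ((4 * Real.pi ^ 2 : ℝ) : ℂ) by push_cast; rfl,
    Complex.norm_of_nonneg (by positivity)]

theorem PairingBound.norm_fejerMean_le {a : ℤ → ℂ} {c : ℝ} (hc : 0 ≤ c) (h : PairingBound a c)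
    (n : ℕ) (t : ℝ) : ‖fejerMean a n t‖ ≤ c / (2 * Real.pi) := by
  have hpi := Real.pi_pos
  have h1 := h.norm_sum_fejerMean_le n {()} (fun _ => 1) (fun _ => t)
  rw [Finset.sum_singleton, one_mul, Complex.norm_conj] at h1
  refine h1.trans ?_
  rw [div_eq_mul_one_div]
  refine mul_le_mul_of_nonneg_left (alexiewiczNorm_le fun α β hαβ hlen => ?_) hc
  rw [integral_fejerComb, Finset.sum_singleton, norm_mul, norm_div, norm_one, norm_four_pi_sq,
    Complex.norm_of_nonneg (sub_nonneg.2 (fejerPrimitive_monotone n (by linarith)))]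
  calc _ ≤ 1 / (4 * Real.pi ^ 2) * (2 * Real.pi) := mul_le_mul_of_nonneg_left
        (fejerPrimitive_sub_le n (by linarith)) (by positivity)
    _ = 1 / (2 * Real.pi) := by field_simp; ring

theorem PairingBound.sum_norm_fejerMean_le {a : ℤ → ℂ} {c : ℝ} (hc : 0 ≤ c)
    (h : PairingBound a c) (n N : ℕ) {s : ℕ → ℝ} (hs : Monotone s)
    (hmem : ∀ i, s i ∈ Icc (-Real.pi) Real.pi) :
    ∑ i ∈ Finset.range N, ‖fejerMean a n (s (i + 1)) - fejerMean a n (s i)‖ ≤ c / Real.pi := by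
  have hpi := Real.pi_pos
  set d : ℕ → ℂ := fun i => fejerMean a n (s (i + 1)) - fejerMean a n (s i) with hd
  -- Phases that turn the sum of norms into a linear expression in the increments; where d i = 0,
  -- the value 0/0 = 0 is harmless.
  set ε : ℕ → ℂ := fun i => d i / (‖d i‖ : ℂ) with hε
  have hε1 : ∀ i, ‖ε i‖ ≤ 1 := fun i => by
    simp only [hε, norm_div, Complex.norm_real, norm_norm]
    exact div_self_le_one _
  have hεd : ∀ i, ε i * (starRingEnd ℂ) (d i) = (‖d i‖ : ℂ) := fun i => by
    rcases eq_or_ne (d i) 0 with h0 | h0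
    · simp [h0]
    · have : (‖d i‖ : ℂ) ≠ 0 := by simpa using h0
      simp only [hε]
      rw [div_mul_eq_mul_div, Complex.mul_conj']
      field_simp
  have h1 := h.norm_sum_fejerMean_le n ((Finset.range N).disjSum (Finset.range N))
    (Sum.elim ε fun i => -ε i) (Sum.elim (fun i => s (i + 1)) s)
  have h2 : ∑ i ∈ (Finset.range N).disjSum (Finset.range N),
      (Sum.elim ε fun i => -ε i) i * (starRingEnd ℂ)
        (fejerMean a n ((Sum.elim (fun i => s (i + 1)) s : ℕ ⊕ ℕ → ℝ) i)) =
      ((∑ i ∈ Finset.range N, ‖d i‖ : ℝ) : ℂ) := by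
    rw [Finset.sum_disjSum, ← Finset.sum_add_distrib, Complex.ofReal_sum]
    refine Finset.sum_congr rfl fun i _ => ?_
    rw [← hεd i]
    simp only [Sum.elim_inl, Sum.elim_inr, hd, map_sub]
    ring
  rw [h2, Complex.norm_of_nonneg (Finset.sum_nonneg fun _ _ => norm_nonneg _)] at h1
  refine h1.trans ?_
  rw [div_eq_mul_one_div]
  refine mul_le_mul_of_nonneg_left (alexiewiczNorm_le fun α β hαβ hlen => ?_) hc
  set Φ := fejerPrimitive n
  -- The nonnegative increments of Φ telescope, and the nodes span at most one period. The endpoints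
  -- α and β contribute 2π each, so the norm is at most 4π/(4π²) = 1/π.
  have htel : ∀ γ, ∑ i ∈ Finset.range N, (Φ (γ - s i) - Φ (γ - s (i + 1))) ≤ 2 * Real.pi := by
    intro γ
    rw [Finset.sum_range_sub' fun i => Φ (γ - s i)]
    exact fejerPrimitive_sub_le n (by linarith [(hmem 0).1, (hmem N).2])
  rw [integral_fejerComb, Finset.sum_disjSum, ← Finset.sum_add_distrib]
  have hterm : ∀ i ∈ Finset.range N,
      ‖(Sum.elim ε fun i => -ε i) (Sum.inl i) / (4 * (Real.pi : ℂ) ^ 2) *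
          ((Φ (β - (Sum.elim (fun i => s (i + 1)) s : ℕ ⊕ ℕ → ℝ) (Sum.inl i)) -
            Φ (α - (Sum.elim (fun i => s (i + 1)) s : ℕ ⊕ ℕ → ℝ) (Sum.inl i)) : ℝ) : ℂ) +
        (Sum.elim ε fun i => -ε i) (Sum.inr i) / (4 * (Real.pi : ℂ) ^ 2) *
          ((Φ (β - (Sum.elim (fun i => s (i + 1)) s : ℕ ⊕ ℕ → ℝ) (Sum.inr i)) -
            Φ (α - (Sum.elim (fun i => s (i + 1)) s : ℕ ⊕ ℕ → ℝ) (Sum.inr i)) : ℝ) : ℂ)‖ ≤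
      1 / (4 * Real.pi ^ 2) * ((Φ (β - s i) - Φ (β - s (i + 1))) +
        (Φ (α - s i) - Φ (α - s (i + 1)))) := by
    intro i _
    have hβ : Φ (β - s (i + 1)) ≤ Φ (β - s i) :=
      fejerPrimitive_monotone n (by linarith [hs i.le_succ])
    have hα : Φ (α - s (i + 1)) ≤ Φ (α - s i) :=
      fejerPrimitive_monotone n (by linarith [hs i.le_succ])
    simp only [Sum.elim_inl, Sum.elim_inr]
    rw [show ε i / (4 * (Real.pi : ℂ) ^ 2) *
          ((Φ (β - s (i + 1)) - Φ (α - s (i + 1)) : ℝ) : ℂ) +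
        -ε i / (4 * (Real.pi : ℂ) ^ 2) * ((Φ (β - s i) - Φ (α - s i) : ℝ) : ℂ) =
      ε i / (4 * (Real.pi : ℂ) ^ 2) * (((Φ (β - s (i + 1)) - Φ (α - s (i + 1))) -
        (Φ (β - s i) - Φ (α - s i)) : ℝ) : ℂ) by push_cast; ring, norm_mul, norm_div,
      norm_four_pi_sq, Complex.norm_real, Real.norm_eq_abs]
    refine mul_le_mul ?_ ?_ (abs_nonneg _) (by positivity)
    · exact div_le_div_of_nonneg_right (hε1 i) (by positivity)
    · rw [abs_le]; constructor <;> linarith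
  refine (norm_sum_le_of_le _ hterm).trans ?_
  rw [← Finset.mul_sum, Finset.sum_add_distrib]
  calc _ ≤ 1 / (4 * Real.pi ^ 2) * (2 * Real.pi + 2 * Real.pi) :=
        mul_le_mul_of_nonneg_left (add_le_add (htel β) (htel α)) (by positivity)
    _ = 1 / Real.pi := by field_simp; ring

theorem PairingBound.eVariationOn_fejerMean_le {a : ℤ → ℂ} {c : ℝ} (hc : 0 ≤ c)
    (h : PairingBound a c) (n : ℕ) :
    eVariationOn (fejerMean a n) (Icc (-Real.pi) Real.pi) ≤ ENNReal.ofReal (c / Real.pi) := by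
  refine iSup_le fun ⟨N, s, hs, hmem⟩ => ?_
  simp_rw [edist_dist, dist_eq_norm]
  rw [← ENNReal.ofReal_sum_of_nonneg fun _ _ => norm_nonneg _]
  exact ENNReal.ofReal_le_ofReal (h.sum_norm_fejerMean_le hc n N hs hmem)

theorem PairingBound.bvNorm_fejerMean_le {a : ℤ → ℂ} {c : ℝ} (hc : 0 ≤ c)
    (h : PairingBound a c) (n : ℕ) : bvNorm (fejerMean a n) ≤ c := by
  have hpi := Real.pi_gt_three
  have hv := h.eVariationOn_fejerMean_le hc n
  have hre : torusVar (fun t => (fejerMean a n t).re) ≤ c / Real.pi :=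
    ENNReal.toReal_le_of_le_ofReal (by positivity) ((eVariationOn_re_le _ _).trans hv)
  have him : torusVar (fun t => (fejerMean a n t).im) ≤ c / Real.pi :=
    ENNReal.toReal_le_of_le_ofReal (by positivity) ((eVariationOn_im_le _ _).trans hv)
  have hre0 : 0 ≤ torusVar (fun t => (fejerMean a n t).re) := ENNReal.toReal_nonneg
  have him0 : 0 ≤ torusVar (fun t => (fejerMean a n t).im) := ENNReal.toReal_nonneg
  have h1 : (⨆ t, ‖fejerMean a n t‖) ≤ c / (2 * Real.pi) :=
    ciSup_le fun t => h.norm_fejerMean_le hc n t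
  -- The factor √2 is rounded up to 2: the total 5c/(2π) is still at most c because π > 3.
  have h2 : Real.sqrt (torusVar (fun t => (fejerMean a n t).re) ^ 2 +
      torusVar (fun t => (fejerMean a n t).im) ^ 2) ≤ 2 * (c / Real.pi) :=
    Real.sqrt_le_iff.2 ⟨by positivity, by nlinarith⟩
  have h3 : c / (2 * Real.pi) + 2 * (c / Real.pi) ≤ c := by
    have : c / (2 * Real.pi) + 2 * (c / Real.pi) = c * (5 / (2 * Real.pi)) := by
      field_simp; ring
    rw [this]
    exact mul_le_of_le_one_right hc ((div_le_one (by positivity)).2 (by linarith))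
  unfold bvNorm
  linarith

/-! ### Limits of the Fejér means along an ultrafilter -/

theorem Ultrafilter.exists_tendsto_of_norm_le {ι E : Type*} [NormedAddCommGroup E] [ProperSpace E]
    (U : Ultrafilter ι) {f : ι → E} {B : ℝ} (hf : ∀ i, ‖f i‖ ≤ B) :
    ∃ x, Tendsto f U (𝓝 x) := by
  obtain ⟨x, -, hx⟩ := (isCompact_closedBall (0 : E) B).ultrafilter_le_nhds' (U.map f)
    (Ultrafilter.mem_map.2 (Filter.mem_of_superset Filter.univ_mem fun i _ => by simpa using hf i))
  exact ⟨x, hx⟩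

/-- Lower semicontinuity of variation. The bounds A i may vary and pass to the limit too, which
keeps the constant c sharp. -/
theorem eVariationOn_le_of_tendsto {ι E : Type*} [PseudoEMetricSpace E] {l : Filter ι} [l.NeBot]
    {F : ι → ℝ → E} {f : ℝ → E} {s : Set ℝ} {A : ι → ℝ} {B : ℝ}
    (hF : ∀ t, Tendsto (fun i => F i t) l (𝓝 (f t)))
    (hA : ∀ i, eVariationOn (F i) s ≤ ENNReal.ofReal (A i)) (hB : Tendsto A l (𝓝 B)) :
    eVariationOn f s ≤ ENNReal.ofReal B := by
  refine le_of_forall_lt fun v hv => ?_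
  obtain ⟨w, hvw, hw⟩ := exists_between hv
  refine hvw.trans_le (ge_of_tendsto (ENNReal.tendsto_ofReal hB) ?_)
  exact (eVariationOn.lowerSemicontinuous_aux (fun t _ => hF t) hw).mono fun i hi =>
    hi.le.trans (hA i)

/-- Ensures that a bound on `bvNorm` carries information: `toReal` would send an infinite variation
to 0. -/
theorem memBV_fejerMean (a : ℤ → ℂ) (n : ℕ) : MemBV (fejerMean a n) :=
  ⟨periodic_fejerMean a n,
    ne_top_of_le_ne_top (boundedVariationOn_fejerMean a n _ _) (eVariationOn_re_le _ _),
    ne_top_of_le_ne_top (boundedVariationOn_fejerMean a n _ _) (eVariationOn_im_le _ _)⟩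

theorem isBVCoeff_of_bvNorm_fejerMean_le {a : ℤ → ℂ} {c : ℝ}
    (h : ∀ n, bvNorm (fejerMean a n) ≤ c) : IsBVCoeff a c := by
  have hle : -Real.pi ≤ Real.pi := by linarith [Real.pi_pos]
  set S : ℕ → ℝ := fun n => ⨆ t, ‖fejerMean a n t‖ with hS
  set A : ℕ → ℝ := fun n => torusVar fun t => (fejerMean a n t).re with hA
  set B : ℕ → ℝ := fun n => torusVar fun t => (fejerMean a n t).im with hB
  have hS0 : ∀ n, 0 ≤ S n := fun n => Real.iSup_nonneg fun _ => norm_nonneg _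
  have hA0 : ∀ n, 0 ≤ A n := fun n => ENNReal.toReal_nonneg
  have hB0 : ∀ n, 0 ≤ B n := fun n => ENNReal.toReal_nonneg
  have hsum : ∀ n, S n + Real.sqrt (A n ^ 2 + B n ^ 2) ≤ c := h
  have hSc : ∀ n, S n ≤ c := fun n => by
    linarith [hsum n, Real.sqrt_nonneg (A n ^ 2 + B n ^ 2)]
  have hAc : ∀ n, A n ≤ c := fun n => by
    have : A n ≤ Real.sqrt (A n ^ 2 + B n ^ 2) := Real.le_sqrt_of_sq_le (by nlinarith [hB0 n])
    linarith [hsum n, hS0 n]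
  have hBc : ∀ n, B n ≤ c := fun n => by
    have : B n ≤ Real.sqrt (A n ^ 2 + B n ^ 2) := Real.le_sqrt_of_sq_le (by nlinarith [hA0 n])
    linarith [hsum n, hS0 n]
  have hc0 : 0 ≤ c := (hS0 0).trans (hSc 0)
  set U := hyperfilter ℕ
  have hnorm : ∀ n t, ‖fejerMean a n t‖ ≤ S n := fun n t => (memBV_fejerMean a n).norm_le t
  have hvre : ∀ n, eVariationOn (fun t => (fejerMean a n t).re) (Icc (-Real.pi) Real.pi) ≤
      ENNReal.ofReal (A n) := fun n =>
    (ENNReal.ofReal_toReal (memBV_fejerMean a n).2.1).ge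
  have hvim : ∀ n, eVariationOn (fun t => (fejerMean a n t).im) (Icc (-Real.pi) Real.pi) ≤
      ENNReal.ofReal (B n) := fun n =>
    (ENNReal.ofReal_toReal (memBV_fejerMean a n).2.2).ge
  choose g hg using fun t => U.exists_tendsto_of_norm_le (f := fun n => fejerMean a n t)
    fun n => (hnorm n t).trans (hSc n)
  -- The sup norm and the two variations get separate limits along the same ultrafilter, so that the
  -- inequality S + √(A² + B²) ≤ c survives by continuity.
  obtain ⟨S', hS'⟩ := U.exists_tendsto_of_norm_le (f := S) fun n => by
    rw [Real.norm_of_nonneg (hS0 n)]; exact hSc n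
  obtain ⟨A', hA'⟩ := U.exists_tendsto_of_norm_le (f := A) fun n => by
    rw [Real.norm_of_nonneg (hA0 n)]; exact hAc n
  obtain ⟨B', hB'⟩ := U.exists_tendsto_of_norm_le (f := B) fun n => by
    rw [Real.norm_of_nonneg (hB0 n)]; exact hBc n
  have hA'0 : 0 ≤ A' := ge_of_tendsto' hA' hA0
  have hB'0 : 0 ≤ B' := ge_of_tendsto' hB' hB0
  have hgre : eVariationOn (fun t => (g t).re) (Icc (-Real.pi) Real.pi) ≤ ENNReal.ofReal A' :=
    eVariationOn_le_of_tendsto (fun t => (Complex.continuous_re.tendsto _).comp (hg t)) hvre hA'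
  have hgim : eVariationOn (fun t => (g t).im) (Icc (-Real.pi) Real.pi) ≤ ENNReal.ofReal B' :=
    eVariationOn_le_of_tendsto (fun t => (Complex.continuous_im.tendsto _).comp (hg t)) hvim hB'
  have hmem : MemBV g := by
    refine ⟨fun t => ?_, ne_top_of_le_ne_top ENNReal.ofReal_ne_top hgre,
      ne_top_of_le_ne_top ENNReal.ofReal_ne_top hgim⟩
    refine tendsto_nhds_unique (hg (t + 2 * Real.pi)) ?_
    simpa only [periodic_fejerMean a _ t] using hg t
  refine ⟨g, hmem, ?_, fun k => ?_⟩
  · have h1 : (⨆ t, ‖g t‖) ≤ S' :=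
      ciSup_le fun t => le_of_tendsto_of_tendsto' (hg t).norm hS' fun n => hnorm n t
    have h2 : torusVar (fun t => (g t).re) ≤ A' := ENNReal.toReal_le_of_le_ofReal hA'0 hgre
    have h3 : torusVar (fun t => (g t).im) ≤ B' := ENNReal.toReal_le_of_le_ofReal hB'0 hgim
    have h2' : 0 ≤ torusVar (fun t => (g t).re) := ENNReal.toReal_nonneg
    have h3' : 0 ≤ torusVar (fun t => (g t).im) := ENNReal.toReal_nonneg
    have h4 : S' + Real.sqrt (A' ^ 2 + B' ^ 2) ≤ c :=
      le_of_tendsto' (hS'.add ((hA'.pow 2).add (hB'.pow 2)).sqrt) hsum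
    refine le_trans (add_le_add h1 (Real.sqrt_le_sqrt ?_)) h4
    gcongr
  · have hvar : ∀ n, eVariationOn (fejerMean a n) (Icc (-Real.pi) Real.pi) ≤
        ENNReal.ofReal (c + c) := fun n => by
      rw [ENNReal.ofReal_add hc0 hc0]
      exact (eVariationOn_le_re_add_im _ _).trans (add_le_add
        ((hvre n).trans (ENNReal.ofReal_le_ofReal (hAc n)))
        ((hvim n).trans (ENNReal.ofReal_le_ofReal (hBc n))))
    -- The coefficients of the means tend to those of g along the ultrafilter, and to a k along
    -- `atTop`, since the Fejér weights tend to 1; uniqueness of limits identifies them.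
    have hlim := tendsto_integral_of_eVariationOn_le hle
      (φ := fun t : ℝ => Complex.exp (Complex.I * ((-k : ℤ) : ℂ) * (t : ℂ)))
      (continuous_exp_int (-k)) (M := 1) (fun t => (norm_exp_int (-k) t).le)
      (add_nonneg hc0 hc0) hvar (eVariationOn_le_of_tendsto hg hvar tendsto_const_nhds) hg
    have hcoeff : ∀ f : ℝ → ℂ, ∫ t in (-Real.pi)..Real.pi,
        Complex.exp (Complex.I * ((-k : ℤ) : ℂ) * (t : ℂ)) * f t = torusFourierCoeff f k := by
      intro f
      refine intervalIntegral.integral_congr fun t _ => ?_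
      rw [mul_comm]
      congr 2
      push_cast; ring
    simp only [hcoeff] at hlim
    exact tendsto_nhds_unique hlim
      ((tendsto_torusFourierCoeff_fejerMean a k).mono_left Nat.hyperfilter_le_atTop)

theorem isBVCoeff_iff_bvNorm_fejerMean_le (a : ℤ → ℂ) (c : ℝ) :
    IsBVCoeff a c ↔ ∀ n : ℕ, bvNorm (fejerMean a n) ≤ c := by
  refine ⟨?_, isBVCoeff_of_bvNorm_fejerMean_le⟩
  rintro ⟨g, hg, hc, ha⟩ n
  obtain rfl : torusFourierCoeff g = a := funext ha
  exact (bvNorm_fejerMean_torusFourierCoeff_le hg n).trans hc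

theorem PairingBound.isBVCoeff {a : ℤ → ℂ} {c : ℝ} (hc : 0 ≤ c) (h : PairingBound a c) :
    IsBVCoeff a c :=
  isBVCoeff_of_bvNorm_fejerMean_le (h.bvNorm_fejerMean_le hc)

theorem theorem11 :
    (∀ a : ℤ → ℂ,
      ((∃ c : ℝ, 0 ≤ c ∧ IsBVCoeff a c) ↔ (∃ c : ℝ, 0 ≤ c ∧ PairingBound a c)) ∧
      (∀ c : ℝ, 0 ≤ c → PairingBound a c → IsBVCoeff a c) ∧
      (∀ c : ℝ, 0 ≤ c → IsBVCoeff a c → PairingBound a (2 * Real.pi * c))) ∧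
    (∀ (a : ℤ → ℂ) (c : ℝ),
      IsBVCoeff a c ↔ ∀ n : ℕ, bvNorm (fejerMean a n) ≤ c) := by
  refine ⟨fun a => ⟨⟨?_, ?_⟩, fun c hc h => h.isBVCoeff hc, fun c _ h => h.pairingBound⟩,
    isBVCoeff_iff_bvNorm_fejerMean_le⟩
  · rintro ⟨c, hc, h⟩
    exact ⟨2 * Real.pi * c, mul_nonneg Real.two_pi_pos.le hc, h.pairingBound⟩
  · rintro ⟨c, hc, h⟩
    exact ⟨c, hc, h.isBVCoeff hc⟩
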